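/- Let $\mathbb D=\{z\in\mathbb C:|z|<1\}$. Let $\mathcal H$ be the class of harmonic functions $f=h+\overline g$ on $\mathbb D$, where $h$ and $g$ are analytic in $\mathbb D$ with $h(z)=z+\sum_{n\ge2}a_nz^n$ and $g(z)=\sum_{n\ge1}b_nz^n$. Let $\mathcal S_H^0$ be the class of those $f\in\mathcal H$ that are univalent (injective) in $\mathbb D$, sense-preserving (that is, $|h'|^2-|g'|^2>0$ in $\mathbb D$) and satisfy $b_1=g'(0)=0$. For $\gamma\in\mathbb R$, let $\mathcal S^0(H_\gamma)$ be the class of those $f\in\mathcal S_H^0$ with $f(\mathbb D)=H_\gamma:=\{w\in\mathbb C:\operatorname{Re}(e^{i\gamma}w)>-1/2\}$. The dilatation of $f=h+\overline g$ is $\omega=g'/h'$. The harmonic convolution of $f=h+\overline g$ and $F=H+\overline G$ in $\mathcal H$, with Taylor coefficients $a_n,b_n$ and $A_n,B_n$, is $$(f*F)(z)=z+\sum_{n\ge2}a_nA_nz^n+\overline{\sum_{n\ge1}b_nB_nz^n}.$$ Let $f_0=h_0+\overline{g_0}$ with $$h_0(z)=\frac{z-z^2/2}{(1-z)^2},\qquad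 g_0(z)=\frac{-z^2/2}{(1-z)^2}.$$ A domain $\Omega\subset\mathbb C$ is convex in the direction $\alpha\in\mathbb R$ if for every $a\in\mathbb C$ the set $\Omega\cap\{a+te^{i\alpha}:t\in\mathbb R\}$ is connected or empty, and a function is convex in the direction $\alpha$ if its image of $\mathbb D$ is. **Theorem.** Let $\gamma,\theta\in\mathbb R$ and $n\in\{1,2\}$, and let $f=h+\overline g\in\mathcal S^0(H_\gamma)$ have the dilatation $\omega(z)=e^{i\theta}z^n$ for $z\in\mathbb D$. Then $f_0*f\in\mathcal S_H^0$, and $f_0*f$ is convex in the direction $-\gamma$. -/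

import Mathlib

namespace HarmonicConvolution

noncomputable section

/-- The open unit disk. -/
def unitDisk : Set ℂ := Metric.ball (0 : ℂ) 1

/-- A complex-valued harmonic function `h + conj g`, given by its analytic part `h` and its
co-analytic part `g`. Only the values on the unit disk matter. -/
structure HarmonicPair where
  h : ℂ → ℂ
  g : ℂ → ℂ

namespace HarmonicPair

/-- The function `f = h + conj g`. -/
def toFun (f : HarmonicPair) (z : ℂ) : ℂ := f.h z + (starRingEnd ℂ) (f.g z)

/-- The class `𝓗`: `h` and `g` are analytic in the unit disk, with
`h(z) = z + ∑_{n ≥ 2} a_n z^n` and `g(z) = ∑_{n ≥ 1} b_n z^n`. -/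
structure MemH (f : HarmonicPair) : Prop where
  analytic_h : AnalyticOnNhd ℂ f.h unitDisk
  analytic_g : AnalyticOnNhd ℂ f.g unitDisk
  h_zero : f.h 0 = 0
  deriv_h_zero : deriv f.h 0 = 1
  g_zero : f.g 0 = 0

/-- The Jacobian `J_f = |h'|² - |g'|²`. -/
def jacobian (f : HarmonicPair) (z : ℂ) : ℝ := ‖deriv f.h z‖ ^ 2 - ‖deriv f.g z‖ ^ 2

/-- The complex dilatation `ω = g' / h'`. -/
def dilatation (f : HarmonicPair) (z : ℂ) : ℂ := deriv f.g z / deriv f.h z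

/-- The class `S_H`: the sense-preserving univalent members of `𝓗`. -/
structure MemSH (f : HarmonicPair) : Prop where
  memH : f.MemH
  sensePreserving : ∀ z ∈ unitDisk, 0 < f.jacobian z
  univalent : Set.InjOn f.toFun unitDisk

/-- The class `S_H^0`: the members of `S_H` with `b_1 = g'(0) = 0`. -/
structure MemSH0 (f : HarmonicPair) : Prop where
  memSH : f.MemSH
  deriv_g_zero : deriv f.g 0 = 0

end HarmonicPair

/-- The slanted half-plane `H_γ = {w : Re (e^{iγ} w) > -1/2}`. -/
def slantedHalfPlane (γ : ℝ) : Set ℂ :=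
  {w : ℂ | -(1 / 2 : ℝ) < (Complex.exp (Complex.I * (γ : ℂ)) * w).re}

/-- The class `S⁰(H_γ)`: the members of `S_H^0` that map the unit disk onto `H_γ`. -/
structure HarmonicPair.MemS0H (γ : ℝ) (f : HarmonicPair) : Prop where
  memSH0 : f.MemSH0
  image_eq : f.toFun '' unitDisk = slantedHalfPlane γ

/-- The `n`-th Taylor coefficient at the origin. -/
def taylorCoeff (φ : ℂ → ℂ) (n : ℕ) : ℂ := iteratedDeriv n φ 0 / (n.factorial : ℂ)

/-- The Hadamard product `∑ a_n A_n z^n` of two power series `∑ a_n z^n` and `∑ A_n z^n`. -/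
def hadamard (φ ψ : ℂ → ℂ) (z : ℂ) : ℂ :=
  ∑' n : ℕ, taylorCoeff φ n * taylorCoeff ψ n * z ^ n

/-- The harmonic convolution of `h + conj g` and `H + conj G`, namely
`∑ a_n A_n z^n + conj (∑ b_n B_n z^n)`. For members of `𝓗` one has `a_0 = b_0 = 0` and
`a_1 = A_1 = 1`, so the first sum is `z + ∑_{n ≥ 2} a_n A_n z^n`. -/
def conv (f F : HarmonicPair) : HarmonicPair where
  h := hadamard f.h F.h
  g := hadamard f.g F.g

/-- The harmonic half-plane mapping `f₀ = h₀ + conj g₀` with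
`h₀(z) = (z - z²/2)/(1-z)²` and `g₀(z) = (-z²/2)/(1-z)²`. -/
def f₀ : HarmonicPair where
  h := fun z => (z - z ^ 2 / 2) / (1 - z) ^ 2
  g := fun z => (-(z ^ 2) / 2) / (1 - z) ^ 2

/-- `Ω` is convex in the direction `γ`: its intersection with each line `a + ℝ e^{iγ}` is
connected or empty. -/
def ConvexInDirection (γ : ℝ) (Ω : Set ℂ) : Prop :=
  ∀ a : ℂ, IsPreconnected
    (Ω ∩ Set.range (fun t : ℝ => a + (t : ℂ) * Complex.exp (Complex.I * (γ : ℂ))))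

end

end HarmonicConvolution

namespace HarmonicConvolution

open Complex Filter Topology Set

/-! Put ε = e^{iγ}, δ = conj ε, ζ = εz. The function εh + δg has the real part of εf, so it maps the
disk into Re w > -1/2. Its derivative at 0 is ε, so equality in the Schwarz lemma makes it ζ/(1-ζ).
With g' = ωh' and u = δ²ω, this determines h': h'(1+u)(1-ζ)² = 1 (`deriv_h_mul_eq_one`).

Since f₀ has coefficients (1±n)/2, the convolution is H + conj G with H = (h + zh')/2 and G = (g -
zg')/2. Two facts follow: |G'| < |H'| (`dilatation_bound`), and (1-ζ)²(H' - δ²G') is the mean of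
(1-u)/(1+u) and (1+ζ)/(1-ζ), both of positive real part.

In the coordinate w = ζ/(1-ζ), the second fact says that K = εH - δG satisfies Re K' ≥ Re w + 1/2.
So K is injective, and each level set of Im K is a graph over the real axis, hence connected. Since
Im K = Im ε(H + conj G), this is convexity in the direction -γ. Along a level set, |G'| < |H'| makes
Re ε(H + conj G) increase with Re K, which gives univalence (`shear_unitDisk`). -/

/-! ### Shears on the half-plane -/

/-- The right half-plane `Re w > -1/2`. -/
def rightHalfPlane : Set ℂ := {w : ℂ | -(1 / 2 : ℝ) < w.re}

lemma isOpen_rightHalfPlane : IsOpen rightHalfPlane :=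
  isOpen_lt continuous_const Complex.continuous_re

lemma convex_rightHalfPlane : Convex ℝ rightHalfPlane :=
  convex_halfSpace_re_gt _

/-- Noshiro–Warschawski: a holomorphic function whose derivative has positive real part on a
convex set is injective there. -/
lemma injOn_of_re_deriv_pos {U : Set ℂ} (hU : Convex ℝ U) {K K' : ℂ → ℂ}
    (hK : ∀ w ∈ U, HasDerivAt K (K' w) w) (hpos : ∀ w ∈ U, 0 < (K' w).re) : InjOn K U := by
  intro a ha b hb hab
  by_contra hne
  have hd : b - a ≠ 0 := sub_ne_zero.mpr (Ne.symm hne)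
  have hseg : ∀ t ∈ Icc (0 : ℝ) 1, a + (t : ℂ) * (b - a) ∈ U := fun t ht => by
    simpa using hU.add_smul_sub_mem ha hb ht
  -- Dividing by `b - a` cancels the chain-rule factor and leaves exactly Re K'.
  have hder : ∀ t ∈ Icc (0 : ℝ) 1,
      HasDerivAt (fun t : ℝ => (K (a + (t : ℂ) * (b - a)) / (b - a)).re)
        (K' (a + (t : ℂ) * (b - a))).re t := fun t ht => by
    have h1 : HasDerivAt (fun s : ℂ => a + s * (b - a)) (b - a) (t : ℂ) := by
      simpa using ((hasDerivAt_id (t : ℂ)).mul_const (b - a)).const_add a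
    have h2 := ((hK _ (hseg t ht)).comp (t : ℂ) h1).div_const (b - a)
    rw [mul_div_cancel_right₀ _ hd] at h2
    exact h2.real_of_complex
  have hmono : StrictMonoOn (fun t : ℝ => (K (a + (t : ℂ) * (b - a)) / (b - a)).re)
      (Icc 0 1) := by
    refine strictMonoOn_of_deriv_pos (convex_Icc 0 1)
      (fun t ht => (hder t ht).continuousAt.continuousWithinAt) fun t ht => ?_
    rw [(hder t (interior_subset ht)).deriv]
    exact hpos _ (hseg t (interior_subset ht))
  have := hmono (left_mem_Icc.mpr zero_le_one) (right_mem_Icc.mpr zero_le_one) zero_lt_one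
  simp [hab] at this

/-- A holomorphic function on the half-plane with `Re K' ≥ Re w + 1/2` has connected level sets
of its imaginary part: they are graphs over the real axis. -/
lemma isPreconnected_im_level {K K' : ℂ → ℂ}
    (hK : ∀ w ∈ rightHalfPlane, HasDerivAt K (K' w) w)
    (hpos : ∀ w ∈ rightHalfPlane, w.re + 1 / 2 ≤ (K' w).re) (c : ℝ) :
    IsPreconnected {w ∈ rightHalfPlane | (K w).im = c} := by
  have hmem : ∀ x ∈ Ioi (-(1 / 2) : ℝ), ∀ y : ℝ, (x + y * I : ℂ) ∈ rightHalfPlane := by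
    intro x hx y
    simpa [rightHalfPlane] using hx
  have hder : ∀ x ∈ Ioi (-(1 / 2) : ℝ), ∀ y : ℝ,
      HasDerivAt (fun y : ℝ => (K (x + y * I)).im) (K' (x + y * I)).re y := by
    intro x hx y
    have h1 : HasDerivAt (fun s : ℂ => (x : ℂ) + s * I) I (y : ℂ) := by
      simpa using ((hasDerivAt_id (y : ℂ)).mul_const I).const_add (x : ℂ)
    -- The factor -i turns the imaginary part into a real part.
    have h2 := (((hK _ (hmem x hx y)).comp (y : ℂ) h1).mul_const (-I)).real_of_complex
    simpa [mul_assoc] using h2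
  have hmono : ∀ x ∈ Ioi (-(1 / 2) : ℝ), StrictMono fun y : ℝ => (K (x + y * I)).im := by
    intro x hx
    refine strictMono_of_deriv_pos fun y => ?_
    rw [(hder x hx y).deriv]
    have h1 := hpos _ (hmem x hx y)
    have h2 : -(1 / 2) < x := hx
    simp at h1
    linarith
  have hex : ∀ x ∈ Ioi (-(1 / 2) : ℝ), ∃ y : ℝ, (K (x + y * I)).im = c := by
    intro x hx
    have h2 : 0 < x + 1 / 2 := by have : -(1 / 2) < x := hx; linarith
    set q : ℝ → ℝ := fun y => (K (x + y * I)).im with hq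
    -- Growth at least linear on each vertical line makes every level attained; strict monotonicity
    -- alone would not.
    have hmd : Monotone fun y => q y - (x + 1 / 2) * y := by
      have hd : ∀ y : ℝ, HasDerivAt (fun y => q y - (x + 1 / 2) * y)
          ((K' (x + y * I)).re - (x + 1 / 2)) y := fun y => by
        have h := (hder x hx y).sub ((hasDerivAt_id y).const_mul (x + 1 / 2))
        rwa [mul_one] at h
      refine monotone_of_deriv_nonneg (fun y => (hd y).differentiableAt) fun y => ?_
      rw [(hd y).deriv]
      have h1 := hpos _ (hmem x hx y)
      simp at h1
      simpa using h1
    have hcont : Continuous q :=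
      continuous_iff_continuousAt.mpr fun y => (hder x hx y).continuousAt
    have htop : Tendsto q atTop atTop := by
      refine tendsto_atTop_mono' _ ?_
        (tendsto_atTop_add_const_left _ (q 0) (tendsto_id.const_mul_atTop h2))
      filter_upwards [eventually_ge_atTop 0] with y hy
      have := hmd hy
      simp at this ⊢
      linarith
    have hbot : Tendsto q atBot atBot := by
      refine tendsto_atBot_mono' _ ?_
        (tendsto_atBot_add_const_left _ (q 0) (tendsto_id.const_mul_atBot h2))
      filter_upwards [eventually_le_atBot 0] with y hy
      have := hmd hy
      simp at this ⊢
      linarith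
    exact hcont.surjective htop hbot c
  choose! η hη using hex
  have hcη : ContinuousOn η (Ioi (-(1 / 2) : ℝ)) := by
    intro x hx
    refine ContinuousAt.continuousWithinAt ?_
    have hc : ∀ y : ℝ, ContinuousAt (fun x : ℝ => (K (x + y * I)).im) x := fun y => by
      have h1 : ContinuousAt (fun x : ℝ => (x + y * I : ℂ)) x := by fun_prop
      exact Complex.continuous_im.continuousAt.comp
        (ContinuousAt.comp (f := fun x : ℝ => (x + y * I : ℂ))
          (hK _ (hmem x hx y)).continuousAt h1)
    -- A strict inequality at height `a` persists for nearby `x`, and monotonicity in y turns it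
    -- into a bound on `η`.
    refine tendsto_order.mpr ⟨fun a ha => ?_, fun a ha => ?_⟩
    · have h1 : (K (x + a * I)).im < c := hη x hx ▸ hmono x hx ha
      filter_upwards [(hc a).eventually_lt_const h1, isOpen_Ioi.mem_nhds hx] with x' h2 h3
      rw [← hη x' h3] at h2
      exact (hmono x' h3).lt_iff_lt.mp h2
    · have h1 : c < (K (x + a * I)).im := hη x hx ▸ hmono x hx ha
      filter_upwards [(hc a).eventually_const_lt h1, isOpen_Ioi.mem_nhds hx] with x' h2 h3
      rw [← hη x' h3] at h2
      exact (hmono x' h3).lt_iff_lt.mp h2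
  have himg : {w ∈ rightHalfPlane | (K w).im = c} =
      (fun x : ℝ => (x + η x * I : ℂ)) '' Ioi (-(1 / 2) : ℝ) := by
    ext w
    constructor
    · rintro ⟨hw, hwc⟩
      refine ⟨w.re, hw, ?_⟩
      have : η w.re = w.im := by
        refine (hmono w.re hw).injective ?_
        simp only [hη w.re hw]
        rw [Complex.re_add_im, hwc]
      simp only [this, Complex.re_add_im]
    · rintro ⟨x, hx, rfl⟩
      exact ⟨hmem x hx _, hη x hx⟩
  rw [himg]
  refine isPreconnected_Ioi.image _ ?_
  exact Complex.continuous_ofReal.continuousOn.add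
    ((Complex.continuous_ofReal.comp_continuousOn hcη).mul continuousOn_const)

/-- An injective holomorphic function with nonvanishing derivative on an open set has a
holomorphic inverse. -/
lemma exists_holomorphic_inverse {U : Set ℂ} (hU : IsOpen U) {K K' : ℂ → ℂ}
    (hK : ∀ w ∈ U, HasDerivAt K (K' w) w) (hne : ∀ w ∈ U, K' w ≠ 0) (hinj : InjOn K U) :
    ∃ g : ℂ → ℂ, ∀ w ∈ U, g (K w) = w ∧ HasDerivAt g (K' w)⁻¹ (K w) := by
  have hd : DifferentiableOn ℂ K U := fun w hw => (hK w hw).differentiableAt.differentiableWithinAt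
  have hopen : IsOpenMap (U.domRestrict K) := by
    rw [isOpenMap_iff_nhds_le]
    rintro ⟨w, hw⟩
    have hs : HasStrictDerivAt K (K' w) w := by
      have := (hd.analyticAt (hU.mem_nhds hw)).hasStrictDerivAt
      rwa [(hK w hw).deriv] at this
    have h1 := hs.map_nhds_eq (hne w hw)
    have h2 : map (U.domRestrict K) (𝓝 ⟨w, hw⟩) = map K (map Subtype.val (𝓝 (⟨w, hw⟩ : U))) := by
      rw [Filter.map_map]; rfl
    rw [h2, map_nhds_subtype_coe_eq_nhds hw (hU.mem_nhds hw), h1]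
    rfl
  let e := OpenPartialHomeomorph.ofContinuousOpenRestrict
    (hinj.toPartialEquiv K U) hd.continuousOn hopen hU
  refine ⟨e.symm, fun w hw => ?_⟩
  have h1 : e.symm (K w) = w := e.left_inv hw
  refine ⟨h1, ?_⟩
  refine e.hasDerivAt_symm (e.map_source hw) (hne w hw) ?_
  rw [h1]
  exact hK w hw

/-- After multiplication by conj (a - b), the numerator has real part |a|² - |b|². -/
lemma re_add_div_sub_pos {a b : ℂ} (h : ‖b‖ < ‖a‖) : 0 < ((a + b) / (a - b)).re := by
  have hne : a - b ≠ 0 := by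
    intro h0
    rw [sub_eq_zero.mp h0] at h
    exact lt_irrefl _ h
  have h1 : (a + b) / (a - b) = (((a + b) * (starRingEnd ℂ) (a - b)) / (normSq (a - b) : ℂ)) := by
    rw [Complex.normSq_eq_conj_mul_self, mul_comm (a + b),
      mul_div_mul_left _ _ ((map_ne_zero _).mpr hne)]
  rw [h1, Complex.div_ofReal_re]
  refine div_pos ?_ (Complex.normSq_pos.mpr hne)
  have h2 : ‖b‖ ^ 2 < ‖a‖ ^ 2 := by gcongr
  rw [← Complex.normSq_eq_norm_sq, ← Complex.normSq_eq_norm_sq, Complex.normSq_apply,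
    Complex.normSq_apply] at h2
  simp
  linarith

/-- The shear theorem on the half-plane. -/
lemma injOn_of_shear {H H' G G' : ℂ → ℂ}
    (hH : ∀ w ∈ rightHalfPlane, HasDerivAt H (H' w) w)
    (hG : ∀ w ∈ rightHalfPlane, HasDerivAt G (G' w) w)
    (hlt : ∀ w ∈ rightHalfPlane, ‖G' w‖ < ‖H' w‖)
    (hpos : ∀ w ∈ rightHalfPlane, w.re + 1 / 2 ≤ (H' w - G' w).re) :
    InjOn (fun w => H w + (starRingEnd ℂ) (G w)) rightHalfPlane := by
  have hK : ∀ w ∈ rightHalfPlane, HasDerivAt (fun w => H w - G w) (H' w - G' w) w :=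
    fun w hw => (hH w hw).sub (hG w hw)
  have hK' : ∀ w ∈ rightHalfPlane, 0 < (H' w - G' w).re := fun w hw => by
    have h1 := hpos w hw
    have h2 : -(1 / 2) < w.re := hw
    linarith
  have hinj := injOn_of_re_deriv_pos convex_rightHalfPlane hK hK'
  obtain ⟨g, hg⟩ := exists_holomorphic_inverse isOpen_rightHalfPlane hK
    (fun w hw h0 => by have := hK' w hw; simp [h0] at this) hinj
  intro a ha b hb hab
  simp only at hab
  have him : (H a - G a).im = (H b - G b).im := by
    have := congrArg Complex.im hab
    simpa [sub_eq_add_neg] using this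
  have hre : (H a + G a).re = (H b + G b).re := by
    have := congrArg Complex.re hab
    simpa using this
  set c := (H b - G b).im with hc
  set L := {w ∈ rightHalfPlane | (H w - G w).im = c}
  set J : Set ℝ := (fun w => (H w - G w).re) '' L
  have hJ : Convex ℝ J := by
    refine Real.convex_iff_isPreconnected.mpr ((isPreconnected_im_level hK hpos c).image _ ?_)
    exact Complex.continuous_re.comp_continuousOn
      fun w hw => (hK w hw.1).continuousAt.continuousWithinAt
  have hline : ∀ w ∈ L, ((H w - G w).re : ℂ) + c * I = H w - G w := by
    rintro w ⟨-, hw⟩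
    rw [← hw, Complex.re_add_im]
  -- On the level set, Re K serves as the parameter, and `v` is the real part of the shear in terms
  -- of it.
  set v : ℝ → ℝ := fun t => (H (g (t + c * I)) + G (g (t + c * I))).re
  have hv : ∀ w ∈ L, HasDerivAt v ((H' w + G' w) / (H' w - G' w)).re (H w - G w).re := by
    intro w hw
    obtain ⟨h1, h2⟩ := hg w hw.1
    have h3 : HasDerivAt (fun t : ℂ => g (t + c * I)) (H' w - G' w)⁻¹ ((H w - G w).re : ℂ) := by
      refine HasDerivAt.comp_add_const _ _ ?_
      rwa [hline w hw]
    have h4 : g (((H w - G w).re : ℂ) + c * I) = w := by rw [hline w hw, h1]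
    have h5 : HasDerivAt (fun w => H w + G w) (H' w + G' w)
        (g (((H w - G w).re : ℂ) + c * I)) := by
      rw [h4]; exact (hH w hw.1).add (hG w hw.1)
    exact (h5.comp ((H w - G w).re : ℂ) h3).real_of_complex
  have hmono : StrictMonoOn v J := by
    refine strictMonoOn_of_deriv_pos hJ ?_ ?_
    · rintro _ ⟨w, hw, rfl⟩
      exact (hv w hw).continuousAt.continuousWithinAt
    · intro t ht
      obtain ⟨w, hw, rfl⟩ := interior_subset ht
      rw [(hv w hw).deriv]
      exact re_add_div_sub_pos (hlt w hw.1)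
  have haL : a ∈ L := ⟨ha, him⟩
  have hbL : b ∈ L := ⟨hb, rfl⟩
  have hval : ∀ w ∈ L, v (H w - G w).re = (H w + G w).re := by
    intro w hw
    simp only [v, hline w hw, (hg w hw.1).1]
  have hreK : (H a - G a).re = (H b - G b).re := by
    refine hmono.injOn (mem_image_of_mem _ haL) (mem_image_of_mem _ hbL) ?_
    rw [hval a haL, hval b hbL, hre]
  exact hinj ha hb (Complex.ext hreK him)

/-! ### Half-plane maps and the Schwarz lemma -/

/-- The half-plane consists of the points nearer to 0 than to -1, so w/(1+w) sends it into the disk.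
-/
lemma norm_lt_norm_one_add {w : ℂ} (hw : w ∈ rightHalfPlane) : ‖w‖ < ‖1 + w‖ := by
  have h : -(1 / 2) < w.re := hw
  refine lt_of_pow_lt_pow_left₀ 2 (norm_nonneg _) ?_
  rw [← Complex.normSq_eq_norm_sq, ← Complex.normSq_eq_norm_sq, Complex.normSq_apply,
    Complex.normSq_apply]
  simp
  nlinarith

lemma one_add_ne_zero_of_mem {w : ℂ} (hw : w ∈ rightHalfPlane) : 1 + w ≠ 0 :=
  norm_pos_iff.mp ((norm_nonneg _).trans_lt (norm_lt_norm_one_add hw))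

/-- By the equality case of the Schwarz lemma, a holomorphic map of the disk to the half-plane
`Re w > -1/2` that fixes the origin and has derivative `ε` of modulus one there is
`ε z / (1 - ε z)`. -/
lemma eq_of_mapsTo_rightHalfPlane {φ : ℂ → ℂ} {ε : ℂ} (hε : ‖ε‖ = 1)
    (hφ : DifferentiableOn ℂ φ unitDisk) (hmaps : MapsTo φ unitDisk rightHalfPlane)
    (h0 : φ 0 = 0) (h1 : deriv φ 0 = ε) {z : ℂ} (hz : z ∈ unitDisk) :
    φ z * (1 - ε * z) = ε * z := by
  have hmem0 : (0 : ℂ) ∈ unitDisk := Metric.mem_ball_self one_pos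
  have hd : DifferentiableOn ℂ (fun z => φ z / (1 + φ z)) unitDisk :=
    hφ.div (hφ.const_add 1) fun z hz => one_add_ne_zero_of_mem (hmaps hz)
  have hder : deriv (fun z => φ z / (1 + φ z)) 0 = ε := by
    have h2 : HasDerivAt φ ε 0 :=
      h1 ▸ (hφ.differentiableAt (Metric.isOpen_ball.mem_nhds hmem0)).hasDerivAt
    have h3 := h2.div (h2.const_add 1) (by simp [h0])
    have h4 : HasDerivAt (fun z => φ z / (1 + φ z)) ε 0 := by simpa [h0] using! h3
    exact h4.deriv
  have hb : MapsTo (fun z => φ z / (1 + φ z)) (Metric.ball 0 1)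
      (Metric.closedBall ((fun z => φ z / (1 + φ z)) 0) 1) := by
    intro z hz
    simp only [h0, zero_div, mem_closedBall_zero_iff, norm_div]
    exact div_le_one_of_le₀ (norm_lt_norm_one_add (hmaps hz)).le (norm_nonneg _)
  have h2 := Complex.affine_of_mapsTo_ball_of_norm_dslope_eq_div hd hb hmem0
    (by rw [dslope_same, hder, hε, div_one]) hz
  have h3 := one_add_ne_zero_of_mem (hmaps hz)
  simp only [dslope_same, hder, h0, zero_div, zero_add, sub_zero, smul_eq_mul] at h2
  rw [div_eq_iff h3] at h2
  linear_combination h2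

/-! ### Taylor coefficients and convolution with f₀ -/

lemma hasSum_taylorCoeff {φ : ℂ → ℂ} (hφ : DifferentiableOn ℂ φ unitDisk) {z : ℂ}
    (hz : z ∈ unitDisk) : HasSum (fun n => taylorCoeff φ n * z ^ n) (φ z) := by
  convert! Complex.hasSum_taylorSeries_on_ball hφ hz using 1
  ext n
  simp only [taylorCoeff, smul_eq_mul, sub_zero]
  ring

lemma taylorCoeff_eq_of_hasSum {φ : ℂ → ℂ} {c : ℕ → ℂ}
    (h : ∀ z ∈ unitDisk, HasSum (fun n => c n * z ^ n) (φ z))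
    (hφ : DifferentiableOn ℂ φ unitDisk) (n : ℕ) : taylorCoeff φ n = c n := by
  have key : ∀ d : ℕ → ℂ, (∀ z ∈ unitDisk, HasSum (fun n => d n * z ^ n) (φ z)) →
      HasFPowerSeriesAt φ (FormalMultilinearSeries.ofScalars ℂ d) 0 := by
    intro d hd
    rw [hasFPowerSeriesAt_iff]
    filter_upwards [Metric.ball_mem_nhds (0 : ℂ) one_pos] with z hz
    simpa [FormalMultilinearSeries.coeff_ofScalars, mul_comm] using hd z hz
  have := congrArg (fun p => FormalMultilinearSeries.coeff p n)
    ((key _ fun z hz => hasSum_taylorCoeff hφ hz).eq_formalMultilinearSeries (key c h))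
  simpa [FormalMultilinearSeries.coeff_ofScalars] using this

lemma differentiableOn_deriv {φ : ℂ → ℂ} (hφ : DifferentiableOn ℂ φ unitDisk) :
    DifferentiableOn ℂ (deriv φ) unitDisk :=
  hφ.deriv Metric.isOpen_ball

lemma hasSum_mul_taylorCoeff {φ : ℂ → ℂ} (hφ : DifferentiableOn ℂ φ unitDisk) {z : ℂ}
    (hz : z ∈ unitDisk) : HasSum (fun n => n * taylorCoeff φ n * z ^ n) (z * deriv φ z) := by
  refine (hasSum_nat_add_iff' 1).mp ?_
  convert! (hasSum_taylorCoeff (differentiableOn_deriv hφ) hz).mul_left z using 1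
  · ext n
    simp only [taylorCoeff, ← iteratedDeriv_succ', Nat.factorial_succ]
    have : (n.factorial : ℂ) ≠ 0 := by exact_mod_cast n.factorial_ne_zero
    have : (n + 1 : ℂ) ≠ 0 := by exact_mod_cast n.succ_ne_zero
    push_cast
    field_simp
    ring
  · simp

lemma one_sub_ne_zero_of_norm_lt {z : ℂ} (hz : ‖z‖ < 1) : 1 - z ≠ 0 := by
  intro h
  rw [← sub_eq_zero.mp h] at hz
  simp at hz

/-- Convolution with a function whose coefficients are `p + q n` for `n ≥ 1`. -/
lemma hadamard_eq {ψ φ : ℂ → ℂ} {p q : ℂ} (hψ : ∀ z ∈ unitDisk,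
      ψ z = p * (1 - z)⁻¹ + q * (z / (1 - z) ^ 2) - p)
    (hφ : DifferentiableOn ℂ φ unitDisk) (h0 : φ 0 = 0) {z : ℂ} (hz : z ∈ unitDisk) :
    hadamard ψ φ z = p * φ z + q * (z * deriv φ z) := by
  have hne : ∀ z ∈ unitDisk, 1 - z ≠ 0 := fun z hz =>
    one_sub_ne_zero_of_norm_lt (mem_ball_zero_iff.mp hz)
  have hd : DifferentiableOn ℂ ψ unitDisk := by
    refine DifferentiableOn.congr ?_ hψ
    intro z hz
    have := hne z hz
    exact DifferentiableAt.differentiableWithinAt (by fun_prop (disch := simpa using this))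
  -- The correction at n = 0 comes from the summand -p; it does no harm below because φ(0) = 0.
  have hc : ∀ n, taylorCoeff ψ n = p + q * n - if n = 0 then p else 0 := by
    refine taylorCoeff_eq_of_hasSum (fun z hz => ?_) hd
    have hz' : ‖z‖ < 1 := mem_ball_zero_iff.mp hz
    rw [hψ z hz]
    convert! (((hasSum_geometric_of_norm_lt_one hz').mul_left p).add
      ((hasSum_coe_mul_geometric_of_norm_lt_one hz').mul_left q)).sub
      (hasSum_ite_eq 0 p) using 1
    ext n
    rcases eq_or_ne n 0 with rfl | hn
    · simp
    · simp only [hn, if_false]; ring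
  have hs := ((hasSum_taylorCoeff hφ hz).mul_left p).add
    ((hasSum_mul_taylorCoeff hφ hz).mul_left q)
  rw [hadamard, ← hs.tsum_eq]
  refine tsum_congr fun n => ?_
  rw [hc]
  rcases eq_or_ne n 0 with rfl | hn
  · simp [taylorCoeff, h0]
  · simp [hn]; ring

/-- Here h₀ is half the sum of z/(1-z) and z/(1-z)²; g₀ is half their difference. -/
lemma hadamard_f₀_h {φ : ℂ → ℂ} (hφ : DifferentiableOn ℂ φ unitDisk) (h0 : φ 0 = 0) {z : ℂ}
    (hz : z ∈ unitDisk) : hadamard f₀.h φ z = (φ z + z * deriv φ z) / 2 := by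
  rw [hadamard_eq (p := 1 / 2) (q := 1 / 2) (fun z hz => ?_) hφ h0 hz]
  · ring
  · have := one_sub_ne_zero_of_norm_lt (mem_ball_zero_iff.mp hz)
    simp only [f₀]
    field_simp
    ring

lemma hadamard_f₀_g {φ : ℂ → ℂ} (hφ : DifferentiableOn ℂ φ unitDisk) (h0 : φ 0 = 0) {z : ℂ}
    (hz : z ∈ unitDisk) : hadamard f₀.g φ z = (φ z - z * deriv φ z) / 2 := by
  rw [hadamard_eq (p := 1 / 2) (q := -(1 / 2)) (fun z hz => ?_) hφ h0 hz]
  · ring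
  · have := one_sub_ne_zero_of_norm_lt (mem_ball_zero_iff.mp hz)
    simp only [f₀]
    field_simp
    ring

/-! ### Dilatation and second derivatives -/

/-- The dilatation of the convolution has modulus less than one. -/
lemma dilatation_bound {ζ c u : ℂ} {n : ℕ} (hn : n = 1 ∨ n = 2) (hc : ‖c‖ = 1) (hζ : ‖ζ‖ < 1)
    (hu : u = c * ζ ^ n) :
    ‖u * (n * (1 - ζ) + 2 * ζ * (1 + u))‖ < ‖2 * (1 + u) - n * u * (1 - ζ)‖ := by
  rcases hn with rfl | rfl
  · have h1 : u * ((1 : ℕ) * (1 - ζ) + 2 * ζ * (1 + u)) = u * (1 + ζ + 2 * ζ * u) := by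
      push_cast; ring
    have h2 : 2 * (1 + u) - (1 : ℕ) * u * (1 - ζ) = 2 + u * (1 + ζ) := by push_cast; ring
    rw [h1, h2]
    have hun : ‖u‖ = ‖ζ‖ := by rw [hu, norm_mul, hc, one_mul, pow_one]
    have h3 : ‖1 + ζ + 2 * ζ * u‖ < ‖2 + u * (1 + ζ)‖ := by
      refine lt_of_pow_lt_pow_left₀ 2 (norm_nonneg _) ?_
      -- This factorization uses |u| = |ζ|.
      have e : ‖2 + u * (1 + ζ)‖ ^ 2 - ‖1 + ζ + 2 * ζ * u‖ ^ 2 =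
          (1 - ‖ζ‖ ^ 2) * (3 + 3 * ‖ζ‖ ^ 2 - 2 * ζ.re + 4 * u.re) := by
        have e1 : u.re * u.re + u.im * u.im = ζ.re * ζ.re + ζ.im * ζ.im := by
          rw [← Complex.normSq_apply, ← Complex.normSq_apply, Complex.normSq_eq_norm_sq,
            Complex.normSq_eq_norm_sq, hun]
        simp only [← Complex.normSq_eq_norm_sq, Complex.normSq_apply]
        simp
        linear_combination (1 + 2 * ζ.re - 3 * (ζ.re * ζ.re + ζ.im * ζ.im)) * e1
      have e2 : ζ.re ≤ ‖ζ‖ := Complex.re_le_norm ζ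
      have e3 : -‖ζ‖ ≤ u.re := by
        rw [← hun]
        exact neg_le_of_abs_le (Complex.abs_re_le_norm u)
      have e4 : 0 < 1 - ‖ζ‖ ^ 2 := by nlinarith [norm_nonneg ζ]
      -- The expression is at least 3(1 - |ζ|)².
      have e5 : 0 < 3 + 3 * ‖ζ‖ ^ 2 - 2 * ζ.re + 4 * u.re := by nlinarith
      have := mul_pos e4 e5
      linarith
    rw [norm_mul, hun]
    exact (mul_le_of_le_one_left (norm_nonneg _) hζ.le).trans_lt h3
  -- For n = 2 the factor 2(1 + ζu) is common to both sides, and the quotient is u itself.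
  · have h1 : u * ((2 : ℕ) * (1 - ζ) + 2 * ζ * (1 + u)) = u * (2 * (1 + ζ * u)) := by
      push_cast; ring
    have h2 : 2 * (1 + u) - (2 : ℕ) * u * (1 - ζ) = 2 * (1 + ζ * u) := by push_cast; ring
    have hun : ‖u‖ = ‖ζ‖ ^ 2 := by rw [hu, norm_mul, hc, one_mul, norm_pow]
    have hu1 : ‖u‖ < 1 := by rw [hun]; exact pow_lt_one₀ (norm_nonneg _) hζ two_ne_zero
    rw [h1, h2, norm_mul u]
    refine mul_lt_of_lt_one_left (norm_pos_iff.mpr (mul_ne_zero two_ne_zero ?_)) hu1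
    have h3 : ‖-(ζ * u)‖ < 1 := by
      rw [norm_neg, norm_mul]
      exact mul_lt_one_of_nonneg_of_lt_one_left (norm_nonneg _) hζ hu1.le
    simpa using one_sub_ne_zero_of_norm_lt h3

/-- The second derivatives of `h` and `g`, multiplied by `z`, when `g' = ω h'` and
`h' (1 + a ω) (1 - ε z)² = 1` with `ω = c zⁿ`. -/
lemma second_deriv_mul {h g ω : ℂ → ℂ} {ε a c : ℂ} {n : ℕ} (hn : n = 1 ∨ n = 2)
    (hh : DifferentiableOn ℂ h unitDisk)
    (hω : ∀ z, ω z = c * z ^ n)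
    (hg' : ∀ z ∈ unitDisk, deriv g z = ω z * deriv h z)
    (hh' : ∀ z ∈ unitDisk, deriv h z * ((1 + a * ω z) * (1 - ε * z) ^ 2) = 1)
    {z : ℂ} (hz : z ∈ unitDisk) :
    z * deriv (deriv h) z * ((1 + a * ω z) * (1 - ε * z)) =
        deriv h z * (2 * (ε * z) * (1 + a * ω z) - n * (a * ω z) * (1 - ε * z)) ∧
      z * deriv (deriv g) z = n * ω z * deriv h z + ω z * (z * deriv (deriv h) z) := by
  have hd : HasDerivAt (deriv h) (deriv (deriv h) z) z :=
    ((differentiableOn_deriv hh).differentiableAt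
      (Metric.isOpen_ball.mem_nhds hz)).hasDerivAt
  have hωd : HasDerivAt ω (c * (n * z ^ (n - 1))) z := by
    rw [show ω = fun z => c * z ^ n from funext hω]
    exact (hasDerivAt_pow n z).const_mul c
  have hzω : z * (c * (n * z ^ (n - 1))) = n * ω z := by
    rw [hω]
    rcases hn with rfl | rfl <;> simp <;> ring
  have hne : 1 - ε * z ≠ 0 := fun h0 => by have := hh' z hz; simp [h0] at this
  refine ⟨?_, ?_⟩
  · have hlin : HasDerivAt (fun z => 1 - ε * z) (-ε) z := by
      simpa using ((hasDerivAt_id z).const_mul ε).const_sub 1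
    -- The product in `hh'` is constant, so its derivative vanishes; one factor 1 - εz is cancelled
    -- afterwards.
    have h1 := hd.mul (((hωd.const_mul a).const_add 1).mul (hlin.pow 2))
    have h2 : HasDerivAt (fun z => deriv h z * ((1 + a * ω z) * (1 - ε * z) ^ 2)) 0 z :=
      (hasDerivAt_const z (1 : ℂ)).congr_of_eventuallyEq
        (eventually_of_mem (Metric.isOpen_ball.mem_nhds hz) hh')
    have h3 := h1.unique h2
    simp only [Pi.mul_apply, Pi.pow_apply, Nat.cast_ofNat, Nat.add_one_sub_one, pow_one] at h3
    refine mul_right_cancel₀ hne ?_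
    linear_combination z * h3 - deriv h z * a * (1 - ε * z) ^ 2 * hzω
  · have h2 : HasDerivAt (deriv g) (c * (n * z ^ (n - 1)) * deriv h z + ω z * deriv (deriv h) z) z :=
      (hωd.mul hd).congr_of_eventuallyEq
        (eventually_of_mem (Metric.isOpen_ball.mem_nhds hz) hg')
    rw [h2.deriv]
    linear_combination deriv h z * hzω

lemma mul_conj_of_norm_eq_one {ε : ℂ} (hε : ‖ε‖ = 1) : ε * (starRingEnd ℂ) ε = 1 := by
  rw [Complex.mul_conj, Complex.normSq_eq_norm_sq, hε]
  simp

/-! ### Transfer to the disk and convexity in a direction -/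

lemma div_one_sub_mem_rightHalfPlane {ζ : ℂ} (hζ : ‖ζ‖ < 1) : ζ / (1 - ζ) ∈ rightHalfPlane := by
  have h1 : 0 < ((1 + ζ) / (1 - ζ)).re := re_add_div_sub_pos (by simpa using hζ)
  have h2 : (1 + ζ) / (1 - ζ) = 1 + 2 * (ζ / (1 - ζ)) := by
    have := one_sub_ne_zero_of_norm_lt hζ
    field_simp
    ring
  rw [h2] at h1
  simp at h1
  change -(1 / 2) < (ζ / (1 - ζ)).re
  linarith

/-- The shear theorem on the unit disk, for shears in a rotated direction. -/
lemma shear_unitDisk {H H' G G' : ℂ → ℂ} {ε : ℂ} (hε : ‖ε‖ = 1)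
    (hH : ∀ z ∈ unitDisk, HasDerivAt H (H' z) z) (hG : ∀ z ∈ unitDisk, HasDerivAt G (G' z) z)
    (hlt : ∀ z ∈ unitDisk, ‖G' z‖ < ‖H' z‖)
    (hpos : ∀ z ∈ unitDisk, ((1 + ε * z) / (1 - ε * z)).re / 2 ≤
      ((1 - ε * z) ^ 2 * (H' z - (starRingEnd ℂ) ε ^ 2 * G' z)).re) :
    InjOn (fun z => H z + (starRingEnd ℂ) (G z)) unitDisk ∧
      ∀ c : ℝ, IsPreconnected
        {z ∈ unitDisk | (ε * H z - (starRingEnd ℂ) ε * G z).im = c} := by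
  set δ := (starRingEnd ℂ) ε with hδ
  have hεδ : ε * δ = 1 := mul_conj_of_norm_eq_one hε
  have hδn : ‖δ‖ = 1 := by rw [hδ, Complex.norm_conj, hε]
  -- `Z` is the inverse of z ↦ εz/(1 - εz).
  set Z : ℂ → ℂ := fun w => δ * (w / (1 + w)) with hZ
  have hZmem : MapsTo Z rightHalfPlane unitDisk := by
    intro w hw
    have h1 := norm_lt_norm_one_add hw
    rw [unitDisk, mem_ball_zero_iff, hZ, norm_mul, hδn, one_mul, norm_div]
    exact (div_lt_one ((norm_nonneg _).trans_lt h1)).mpr h1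
  have hZd : ∀ w ∈ rightHalfPlane, HasDerivAt Z (δ * (1 - ε * Z w) ^ 2) w := by
    intro w hw
    have hne := one_add_ne_zero_of_mem hw
    have h1 := ((hasDerivAt_id w).div ((hasDerivAt_id w).const_add 1) hne).const_mul δ
    have h2 : δ * (1 - ε * Z w) ^ 2 = δ * ((1 * (1 + w) - w * 1) / (1 + w) ^ 2) := by
      have : 1 - ε * Z w = 1 / (1 + w) := by
        simp only [hZ]
        rw [← mul_assoc, hεδ]
        field_simp
        ring
      rw [this]
      field_simp
      ring
    rw [h2]
    exact h1
  have hZinv : ∀ z ∈ unitDisk, ε * z / (1 - ε * z) ∈ rightHalfPlane ∧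
      Z (ε * z / (1 - ε * z)) = z := by
    intro z hz
    have h1 : ‖ε * z‖ < 1 := by rw [norm_mul, hε, one_mul]; exact mem_ball_zero_iff.mp hz
    have hne := one_sub_ne_zero_of_norm_lt h1
    refine ⟨div_one_sub_mem_rightHalfPlane h1, ?_⟩
    have h2 : ε * z / (1 - ε * z) / (1 + ε * z / (1 - ε * z)) = ε * z := by
      have : 1 + ε * z / (1 - ε * z) = 1 / (1 - ε * z) := by field_simp; ring
      rw [this]
      field_simp
    simp only [hZ]
    rw [h2]
    linear_combination z * hεδ
  have hHt : ∀ w ∈ rightHalfPlane,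
      HasDerivAt (fun w => ε * H (Z w)) ((1 - ε * Z w) ^ 2 * H' (Z w)) w := by
    intro w hw
    have h1 := ((hH _ (hZmem hw)).comp w (hZd w hw)).const_mul ε
    convert! h1 using 1
    linear_combination (-(1 - ε * Z w) ^ 2 * H' (Z w)) * hεδ
  have hGt : ∀ w ∈ rightHalfPlane,
      HasDerivAt (fun w => δ * G (Z w)) ((1 - ε * Z w) ^ 2 * (δ ^ 2 * G' (Z w))) w := by
    intro w hw
    have h1 := ((hG _ (hZmem hw)).comp w (hZd w hw)).const_mul δ
    convert! h1 using 1
    ring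
  have hne : ∀ w ∈ rightHalfPlane, 1 - ε * Z w ≠ 0 := by
    intro w hw
    refine one_sub_ne_zero_of_norm_lt ?_
    rw [norm_mul, hε, one_mul]
    exact mem_ball_zero_iff.mp (hZmem hw)
  have hltt : ∀ w ∈ rightHalfPlane,
      ‖(1 - ε * Z w) ^ 2 * (δ ^ 2 * G' (Z w))‖ < ‖(1 - ε * Z w) ^ 2 * H' (Z w)‖ := by
    intro w hw
    rw [norm_mul, norm_mul _ (H' _), norm_mul (δ ^ 2), norm_pow δ, hδn, one_pow, one_mul]
    exact mul_lt_mul_of_pos_left (hlt _ (hZmem hw)) (norm_pos_iff.mpr (pow_ne_zero 2 (hne w hw)))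
  have hpost : ∀ w ∈ rightHalfPlane, w.re + 1 / 2 ≤
      ((1 - ε * Z w) ^ 2 * H' (Z w) - (1 - ε * Z w) ^ 2 * (δ ^ 2 * G' (Z w))).re := by
    intro w hw
    rw [← mul_sub]
    refine le_trans (le_of_eq ?_) (hpos _ (hZmem hw))
    have h1 := one_add_ne_zero_of_mem hw
    have h2 : (1 + ε * Z w) / (1 - ε * Z w) = 1 + 2 * w := by
      rw [div_eq_iff (hne w hw)]
      simp only [hZ]
      rw [← mul_assoc, hεδ]
      field_simp
      ring
    rw [h2]
    simp
    ring
  constructor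
  · have hinj := injOn_of_shear hHt hGt hltt hpost
    intro z₁ hz₁ z₂ hz₂ h
    obtain ⟨hm₁, he₁⟩ := hZinv z₁ hz₁
    obtain ⟨hm₂, he₂⟩ := hZinv z₂ hz₂
    -- The half-plane shear is εH + conj (δG) = ε(H + conj G).
    have h1 := hinj hm₁ hm₂ (by
      simp only [he₁, he₂, map_mul, hδ, Complex.conj_conj, ← mul_add]
      exact congrArg (ε * ·) h)
    rw [← he₁, ← he₂, h1]
  · intro c
    have h1 := isPreconnected_im_level (fun w hw => (hHt w hw).sub (hGt w hw)) hpost c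
    have h2 : {z ∈ unitDisk | (ε * H z - δ * G z).im = c} =
        Z '' {w ∈ rightHalfPlane | (ε * H (Z w) - δ * G (Z w)).im = c} := by
      ext z
      constructor
      · rintro ⟨hz, hzc⟩
        obtain ⟨hm, he⟩ := hZinv z hz
        exact ⟨_, ⟨hm, by rwa [he]⟩, he⟩
      · rintro ⟨w, ⟨hw, hwc⟩, rfl⟩
        exact ⟨hZmem hw, hwc⟩
    rw [h2]
    exact h1.image _ fun w hw => (hZd w hw.1).continuousAt.continuousWithinAt

/-- A shear whose level sets are connected is convex in the direction of the shear. -/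
lemma convexInDirection_of_isPreconnected_level {F : ℂ → ℂ} (γ : ℝ) {U : Set ℂ}
    (hF : ContinuousOn F U)
    (h : ∀ c : ℝ, IsPreconnected {z ∈ U | (Complex.exp (I * γ) * F z).im = c}) :
    ConvexInDirection (-γ) (F '' U) := by
  intro a
  have hexp : Complex.exp (I * γ) * Complex.exp (I * ((-γ : ℝ) : ℂ)) = 1 := by
    rw [← Complex.exp_add]
    simp
  set ε := Complex.exp (I * γ)
  set δ := Complex.exp (I * ((-γ : ℝ) : ℂ))
  -- The line a + ℝδ is the set of p with Im εp = Im εa.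
  convert (h (ε * a).im).image F (hF.mono fun z hz => hz.1) using 1
  ext p
  constructor
  · rintro ⟨⟨z, hz, rfl⟩, t, ht⟩
    refine ⟨z, ⟨hz, ?_⟩, rfl⟩
    rw [← ht, show ε * (a + t * δ) = ε * a + t by linear_combination (t : ℂ) * hexp]
    simp
  · rintro ⟨z, ⟨hz, hzc⟩, rfl⟩
    refine ⟨⟨z, hz, rfl⟩, (ε * F z - ε * a).re, ?_⟩
    have h1 : (((ε * F z - ε * a).re : ℝ) : ℂ) = ε * F z - ε * a := by
      apply Complex.ext
      · simp
      · rw [Complex.sub_im, hzc]; simp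
    simp only [h1]
    linear_combination (F z - a) * hexp

/-- The analytic part of a half-plane mapping with dilatation `ω`. -/
lemma deriv_h_mul_eq_one {γ : ℝ} {f : HarmonicPair} (hf : f.MemS0H γ) {ω : ℂ → ℂ}
    (hg' : ∀ z ∈ unitDisk, deriv f.g z = ω z * deriv f.h z) {z : ℂ} (hz : z ∈ unitDisk) :
    deriv f.h z * ((1 + (starRingEnd ℂ) (Complex.exp (I * γ)) ^ 2 * ω z) *
      (1 - Complex.exp (I * γ) * z) ^ 2) = 1 := by
  have hε : ‖Complex.exp (I * γ)‖ = 1 := by rw [mul_comm]; exact Complex.norm_exp_ofReal_mul_I γ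
  have himg := hf.image_eq
  have hmemH := hf.memSH0.memSH.memH
  simp only [slantedHalfPlane] at himg
  set ε := Complex.exp (I * γ)
  set δ := (starRingEnd ℂ) ε with hδ
  have hεδ : ε * δ = 1 := mul_conj_of_norm_eq_one hε
  have hh : ∀ z ∈ unitDisk, HasDerivAt f.h (deriv f.h z) z := fun z hz =>
    (hmemH.analytic_h z hz).differentiableAt.hasDerivAt
  have hg : ∀ z ∈ unitDisk, HasDerivAt f.g (deriv f.g z) z := fun z hz =>
    (hmemH.analytic_g z hz).differentiableAt.hasDerivAt
  set φ : ℂ → ℂ := fun z => ε * f.h z + δ * f.g z with hφdef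
  have hφ : ∀ z ∈ unitDisk, HasDerivAt φ (ε * deriv f.h z + δ * deriv f.g z) z := fun z hz =>
    ((hh z hz).const_mul ε).add ((hg z hz).const_mul δ)
  have hmaps : MapsTo φ unitDisk rightHalfPlane := by
    intro z hz
    have h1 : f.toFun z ∈ {w : ℂ | -(1 / 2 : ℝ) < (ε * w).re} := himg ▸ mem_image_of_mem _ hz
    -- Conjugating the summand ε conj g does not change its real part.
    have h2 : (ε * f.toFun z).re = (φ z).re := by
      simp [HarmonicPair.toFun, hφdef, hδ]
      ring
    change -(1 / 2 : ℝ) < (φ z).re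
    rw [← h2]
    exact h1
  have h0 : (0 : ℂ) ∈ unitDisk := Metric.mem_ball_self one_pos
  have hformula : ∀ z ∈ unitDisk, φ z * (1 - ε * z) = ε * z := fun z hz =>
    eq_of_mapsTo_rightHalfPlane hε
      (fun z hz => (hφ z hz).differentiableAt.differentiableWithinAt) hmaps
      (by simp [hφdef, hmemH.h_zero, hmemH.g_zero])
      (by rw [(hφ 0 h0).deriv, hmemH.deriv_h_zero, hf.memSH0.deriv_g_zero]; ring) hz
  have hlin : HasDerivAt (fun z => ε * z) ε z := by
    simpa using (hasDerivAt_id z).const_mul ε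
  have h1 := (hφ z hz).mul (hlin.const_sub 1)
  have h2 := h1.unique (hlin.congr_of_eventuallyEq
    (eventually_of_mem (Metric.isOpen_ball.mem_nhds hz) hformula))
  rw [hg' z hz] at h2
  have h3 := hformula z hz
  refine mul_left_cancel₀ (left_ne_zero_of_mul_eq_one hεδ) ?_
  linear_combination (1 - ε * z) * h2 + ε * h3 +
    (δ * ω z * deriv f.h z * (1 - ε * z) ^ 2) * hεδ

end HarmonicConvolution

/-! ### The theorem -/

open HarmonicConvolution in
theorem mainTheorem1 (γ θ : ℝ) (n : ℕ) (hn : n = 1 ∨ n = 2)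
    (f : HarmonicConvolution.HarmonicPair) (hf : f.MemS0H γ)
    (hω : ∀ z ∈ HarmonicConvolution.unitDisk,
      f.dilatation z = Complex.exp (Complex.I * (θ : ℂ)) * z ^ n) :
    (HarmonicConvolution.conv HarmonicConvolution.f₀ f).MemSH0 ∧
      HarmonicConvolution.ConvexInDirection (-γ)
        ((HarmonicConvolution.conv HarmonicConvolution.f₀ f).toFun ''
          HarmonicConvolution.unitDisk) := by
  have hε : ‖Complex.exp (Complex.I * γ)‖ = 1 := by
    rw [mul_comm]; exact Complex.norm_exp_ofReal_mul_I γ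
  have hκ : ‖Complex.exp (Complex.I * θ)‖ = 1 := by
    rw [mul_comm]; exact Complex.norm_exp_ofReal_mul_I θ
  have hmemH := hf.memSH0.memSH.memH
  have hg' : ∀ z ∈ unitDisk,
      deriv f.g z = Complex.exp (Complex.I * θ) * z ^ n * deriv f.h z := by
    intro z hz
    have h1 := hf.memSH0.memSH.sensePreserving z hz
    have h2 : deriv f.h z ≠ 0 := by
      intro h0
      simp only [HarmonicPair.jacobian, h0] at h1
      have := sq_nonneg ‖deriv f.g z‖
      simp at h1
      linarith
    rw [← hω z hz, HarmonicPair.dilatation, div_mul_cancel₀ _ h2]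
  have hh' := fun z hz => deriv_h_mul_eq_one hf
    (ω := fun z => Complex.exp (Complex.I * θ) * z ^ n) hg' (z := z) hz
  have hhd : DifferentiableOn ℂ f.h unitDisk := hmemH.analytic_h.differentiableOn
  have hgd : DifferentiableOn ℂ f.g unitDisk := hmemH.analytic_g.differentiableOn
  have hopen : IsOpen unitDisk := Metric.isOpen_ball
  have h0 : (0 : ℂ) ∈ unitDisk := Metric.mem_ball_self one_pos
  set H := hadamard f₀.h f.h
  set G := hadamard f₀.g f.g
  have hH : ∀ z ∈ unitDisk,
      HasDerivAt H ((2 * deriv f.h z + z * deriv (deriv f.h) z) / 2) z := by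
    intro z hz
    have h1 := (hhd.differentiableAt (hopen.mem_nhds hz)).hasDerivAt
    have h2 := ((differentiableOn_deriv hhd).differentiableAt (hopen.mem_nhds hz)).hasDerivAt
    have h3 := (h1.add ((hasDerivAt_id z).mul h2)).div_const 2
    have h4 : HasDerivAt (fun z => (f.h z + z * deriv f.h z) / 2)
        ((2 * deriv f.h z + z * deriv (deriv f.h) z) / 2) z := by
      convert! h3 using 1
      simp only [id]
      ring
    exact h4.congr_of_eventuallyEq (Filter.eventually_of_mem (hopen.mem_nhds hz)
      fun z hz => hadamard_f₀_h hhd hmemH.h_zero hz)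
  have hG : ∀ z ∈ unitDisk, HasDerivAt G (-(z * deriv (deriv f.g) z) / 2) z := by
    intro z hz
    have h1 := (hgd.differentiableAt (hopen.mem_nhds hz)).hasDerivAt
    have h2 := ((differentiableOn_deriv hgd).differentiableAt (hopen.mem_nhds hz)).hasDerivAt
    have h3 := (h1.sub ((hasDerivAt_id z).mul h2)).div_const 2
    have h4 : HasDerivAt (fun z => (f.g z - z * deriv f.g z) / 2)
        (-(z * deriv (deriv f.g) z) / 2) z := by
      convert! h3 using 1
      simp only [id]
      ring
    exact h4.congr_of_eventuallyEq (Filter.eventually_of_mem (hopen.mem_nhds hz)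
      fun z hz => hadamard_f₀_g hgd hmemH.g_zero hz)
  have hconn : ∀ c : ℝ, {z ∈ unitDisk | (Complex.exp (Complex.I * γ) *
      (conv f₀ f).toFun z).im = c} = {z ∈ unitDisk | (Complex.exp (Complex.I * γ) * H z -
        (starRingEnd ℂ) (Complex.exp (Complex.I * γ)) * G z).im = c} := by
    intro c
    ext z
    have : (Complex.exp (Complex.I * γ) * (conv f₀ f).toFun z).im =
        (Complex.exp (Complex.I * γ) * H z -
          (starRingEnd ℂ) (Complex.exp (Complex.I * γ)) * G z).im := by
      simp only [HarmonicPair.toFun, conv, Complex.mul_im, Complex.add_im, Complex.add_re,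
        Complex.sub_im, Complex.conj_re, Complex.conj_im, H, G]
      ring
    simp only [Set.mem_ofPred_eq, this]
  -- The two hypotheses of the shear theorem: |G'| < |H'| and the lower bound on Re K'.
  suffices hmain : (∀ z ∈ unitDisk, ‖-(z * deriv (deriv f.g) z) / 2‖ <
        ‖(2 * deriv f.h z + z * deriv (deriv f.h) z) / 2‖) ∧
      ∀ z ∈ unitDisk, ((1 + Complex.exp (Complex.I * γ) * z) /
        (1 - Complex.exp (Complex.I * γ) * z)).re / 2 ≤
        ((1 - Complex.exp (Complex.I * γ) * z) ^ 2 *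
          ((2 * deriv f.h z + z * deriv (deriv f.h) z) / 2 -
            (starRingEnd ℂ) (Complex.exp (Complex.I * γ)) ^ 2 *
              (-(z * deriv (deriv f.g) z) / 2))).re by
    obtain ⟨hinj, hlev⟩ := shear_unitDisk hε hH hG hmain.1 hmain.2
    have hHd : DifferentiableOn ℂ H unitDisk := fun z hz =>
      (hH z hz).differentiableAt.differentiableWithinAt
    have hGd : DifferentiableOn ℂ G unitDisk := fun z hz =>
      (hG z hz).differentiableAt.differentiableWithinAt
    refine ⟨⟨⟨⟨hHd.analyticOnNhd hopen, hGd.analyticOnNhd hopen, ?_, ?_, ?_⟩, ?_, hinj⟩, ?_⟩, ?_⟩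
    · exact (hadamard_f₀_h hhd hmemH.h_zero h0).trans (by simp [hmemH.h_zero])
    · exact (hH 0 h0).deriv.trans (by simp [hmemH.deriv_h_zero])
    · exact (hadamard_f₀_g hgd hmemH.g_zero h0).trans (by simp [hmemH.g_zero])
    · intro z hz
      change 0 < ‖deriv H z‖ ^ 2 - ‖deriv G z‖ ^ 2
      rw [(hH z hz).deriv, (hG z hz).deriv, sub_pos]
      exact pow_lt_pow_left₀ (hmain.1 z hz) (norm_nonneg _) two_ne_zero
    · exact (hG 0 h0).deriv.trans (by simp)
    · refine convexInDirection_of_isPreconnected_level γ ?_ fun c => ?_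
      · exact hHd.continuousOn.add (Complex.continuous_conj.comp_continuousOn hGd.continuousOn)
      · rw [hconn]
        exact hlev c
  set ε := Complex.exp (Complex.I * γ)
  set κ := Complex.exp (Complex.I * θ)
  set δ := (starRingEnd ℂ) ε with hδ
  have hεδ : ε * δ = 1 := mul_conj_of_norm_eq_one hε
  have hδn : ‖δ‖ = 1 := by rw [hδ, Complex.norm_conj, hε]
  rw [← forall₂_and]
  intro z hz
  obtain ⟨hk, hl⟩ := second_deriv_mul hn hhd (fun _ => rfl) hg' hh' hz
  have hone := hh' z hz
  have hζ : ‖ε * z‖ < 1 := by rw [norm_mul, hε, one_mul]; exact mem_ball_zero_iff.mp hz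
  set u := δ ^ 2 * (κ * z ^ n) with hu
  have hu' : u = (δ ^ 2 * κ * δ ^ n) * (ε * z) ^ n := by
    have : δ ^ n * ε ^ n = 1 := by rw [← mul_pow, mul_comm, hεδ, one_pow]
    rw [hu, mul_pow]
    linear_combination (-(δ ^ 2 * κ * z ^ n)) * this
  have hc : ‖δ ^ 2 * κ * δ ^ n‖ = 1 := by simp [hδn, hκ]
  have hbound := dilatation_bound hn hc hζ hu'
  have hun : ‖u‖ < 1 := by
    rw [hu', norm_mul, hc, one_mul, norm_pow]
    exact pow_lt_one₀ (norm_nonneg _) hζ (by omega)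
  have hne1 : 1 - ε * z ≠ 0 := one_sub_ne_zero_of_norm_lt hζ
  have hne2 : 1 + u ≠ 0 := by
    simpa using one_sub_ne_zero_of_norm_lt (z := -u) (by simpa using hun)
  set p := deriv f.h z
  set q := deriv (deriv f.h) z
  set r := deriv (deriv f.g) z
  set m := (1 + u) * (1 - ε * z) with hm
  have hmne : m ≠ 0 := mul_ne_zero hne2 hne1
  have hpne : p ≠ 0 := left_ne_zero_of_mul_eq_one hone
  -- `hA` and `hB` write 2H' and -2δ²G' over the common denominator `m`; their quotient is the one
  -- in `dilatation_bound`.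
  have hA : (2 * p + z * q) * m = p * (2 * (1 + u) - n * u * (1 - ε * z)) := by
    linear_combination hk
  have hB : δ ^ 2 * (z * r) * m = p * (u * (n * (1 - ε * z) + 2 * (ε * z) * (1 + u))) := by
    linear_combination u * hk + δ ^ 2 * m * hl
  constructor
  · have h1 : ‖z * r‖ * ‖m‖ < ‖2 * p + z * q‖ * ‖m‖ := by
      calc ‖z * r‖ * ‖m‖ = ‖δ ^ 2 * (z * r) * m‖ := by simp [hδn]
        _ = ‖p‖ * ‖u * (n * (1 - ε * z) + 2 * (ε * z) * (1 + u))‖ := by rw [hB, norm_mul]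
        _ < ‖p‖ * ‖2 * (1 + u) - n * u * (1 - ε * z)‖ :=
          mul_lt_mul_of_pos_left hbound (norm_pos_iff.mpr hpne)
        _ = ‖2 * p + z * q‖ * ‖m‖ := by rw [← norm_mul, ← hA, norm_mul]
    have h2 := lt_of_mul_lt_mul_right h1 (norm_nonneg _)
    rw [norm_div, norm_div, norm_neg]
    gcongr
    simp
  · have h1 : (1 - ε * z) ^ 2 * ((2 * p + z * q) / 2 - δ ^ 2 * (-(z * r) / 2)) =
        ((1 + -u) / (1 - -u) + (1 + ε * z) / (1 - ε * z)) / 2 := by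
      have hne3 : 1 - -u ≠ 0 := by simpa using hne2
      refine mul_right_cancel₀ hmne ?_
      have h2 : ((1 + -u) / (1 - -u) + (1 + ε * z) / (1 - ε * z)) / 2 * m =
          1 + u * (ε * z) := by
        rw [hm]
        field_simp
        ring
      rw [h2]
      linear_combination (1 - ε * z) ^ 2 / 2 * (hA + hB) + (1 + u * (ε * z)) * hone
    have h2 : 0 < ((1 + -u) / (1 - -u)).re := re_add_div_sub_pos (by simpa using hun)
    rw [h1, show (2 : ℂ) = ((2 : ℝ) : ℂ) by simp, Complex.div_ofReal_re, Complex.add_re]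
    linarith
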